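/- For a field $K$ and a non-constant monic polynomial $f=x^n+a_1x^{n-1}+\dots+a_n\in K[x]$ of degree $n$, put $a_0=1$ and let $H_i(f)=\sum_{k=0}^{n-i}\binom{n-k}{i}a_kx^{n-k-i}$ be its $i$-th Hasse derivative. Call $f$ a Casas--Alvero polynomial if for each $i\in\{1,\dots,n-1\}$ it has a non-constant common factor with $H_i(f)$ (if $H_i(f)=0$, this condition holds). For $p$ zero or a prime number, let $\mathrm{CA}_{n,p}$ be the statement: for every algebraically closed field $K$ of characteristic $p$ and every Casas--Alvero polynomial $f\in K[x]$ of degree $n$ there is $b\in K$ with $f=(x-b)^n$. A prime number $p$ is a bad prime for $n$ if $\mathrm{CA}_{n,p}$ is false. Let $n\ge 1$ be an integer, $d=\frac{n^2-3n+4}{2}$ and $C=\binom{(n^2-n)/2}{\,n-2\,}$ (with $\binom{a}{-1}=0$). If $\mathrm{CA}_{n,0}$ holds and $p$ is a bad prime for $n$, then $$p<C!\prod_{i=1}^{n-1}\binom{i+n-2}{n-2}^{\binom{d-i+n-2}{n-2}}.$$ -/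

import Mathlib

universe u v

/-- Two polynomials have a non-constant common factor. When `g = 0`, every divisor of `f`
is a common factor. -/
def HasNonconstantCommonFactor {K : Type u} [Field K] (f g : Polynomial K) : Prop :=
  ∃ h : Polynomial K, 0 < h.natDegree ∧ h ∣ f ∧ h ∣ g

/-- A non-constant monic polynomial is a Casas-Alvero polynomial if it has a non-constant common
factor with each of its Hasse derivatives of order `1, …, n - 1`, where `n` is its degree. -/
structure IsCasasAlvero {K : Type u} [Field K] (f : Polynomial K) : Prop where
  monic : f.Monic
  natDegree_pos : 0 < f.natDegree
  commonFactor : ∀ i : ℕ, 1 ≤ i → i ≤ f.natDegree - 1 →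
    HasNonconstantCommonFactor f (Polynomial.hasseDeriv i f)

/-- `CA n p`: the Casas-Alvero conjecture holds for polynomials of degree `n` over algebraically
closed fields of characteristic `p` (where `p = 0` or `p` is prime). -/
def CA (n p : ℕ) : Prop :=
  ∀ (K : Type u) [Field K] [IsAlgClosed K] [CharP K p] (f : Polynomial K),
    IsCasasAlvero f → f.natDegree = n →
      ∃ b : K, f = (Polynomial.X - Polynomial.C b) ^ n

/-- `p` is a bad prime for `n` if `p` is prime and `CA n p` is false. -/
def IsBadPrime (n p : ℕ) : Prop :=
  p.Prime ∧ ¬ CA.{u} n p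

/-- The number `d = (n² - 3n + 4) / 2`. The numerator is a positive even number for every `n`,
and is arranged so that the subtraction of natural numbers does not truncate. -/
def critDegree (n : ℕ) : ℕ := (n ^ 2 + 4 - 3 * n) / 2

/-- The number `C = binom((n² - n) / 2, n - 2)`. -/
def numMonomials (n : ℕ) : ℕ := ((n ^ 2 - n) / 2).choose (n - 2)

/-!
Write `n = m + 1`. If a polynomial `f` of degree `n` has the roots `ρ none, ρ 0, …, ρ (m - 1)`,
then the value of its Hasse derivative of order `n - i` at `ρ j` is the `i`-th elementary symmetric
function of the differences `ρ j - ρ l`. With `x l = ρ l - ρ none` it is an integral form of degree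
`i` in `m` variables, `hasseForm m i j`, whose coefficients are at most `m.choose i` in absolute
value. So Casas-Alvero polynomials correspond to common zeros of systems of `m` forms of
the degrees `1, …, m` in `m` variables, one system for each choice of common roots, and `CA n p`
says that these systems have only the trivial zero in characteristic `p`.

The tool for comparing characteristics is the Macaulay matrix of such a system in degree
`d = ∑ (i - 1) + 1 = critDegree n`, whose rows are the products of degree `d` of a form and a
monomial, and whose columns belong to the `numMonomials n` monomials of degree `d`. By Macaulay's
theorem (`MvPolynomial.mem_span_range_of_isHomogeneous`), if the system has only the trivial zero
in characteristic zero, then the forms generate everything in degree `d`, and hence some maximal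
minor is a nonzero integer. A nontrivial zero in characteristic `p` gives a kernel vector of the
matrix modulo `p`, so `p` divides the minor, and the Leibniz formula bounds the minor. The bound is
either `1` or a multiple of `6`, so the prime `p` cannot be equal to it.

Macaulay's theorem rests on the fact that `m` forms in `m` variables with only the trivial zero are
a regular sequence, so that the Hilbert function of the ideal depends on the degrees only and can be
read off from powers of the variables. Regularity is proved in the local ring at the origin, where
the variables are a regular system of parameters: any system of parameters can be reached from it by
exchanging one member at a time, and an exchange preserves regularity
(`isWeaklyRegular_append_of_isWeaklyRegular_append`).
-/

/-! ### Systems of parameters and regular sequences in local rings -/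

open RingTheory.Sequence in
/-- A regular sequence stays regular when its last member is replaced by `c`, as soon as the
old last member is nilpotent modulo the new sequence: if `b` is a nonzerodivisor modulo `L` and
`b ^ N = u * c` there, then so is `c`. -/
theorem isWeaklyRegular_concat_of_mem_radical {R : Type*} [CommRing R] {L : List R} {b c : R}
    (h : IsWeaklyRegular R (L ++ [b])) (hb : b ∈ (Ideal.ofList (L ++ [c])).radical) :
    IsWeaklyRegular R (L ++ [c]) := by
  rw [isWeaklyRegular_append_iff, isWeaklyRegular_singleton_iff] at h ⊢
  refine ⟨h.1, ?_⟩
  obtain ⟨N, hN⟩ := hb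
  rw [Ideal.ofList_append, Ideal.ofList_singleton, Submodule.mem_sup] at hN
  obtain ⟨y, hy, z, hz, hyz⟩ := hN
  obtain ⟨u, rfl⟩ := Ideal.mem_span_singleton'.mp hz
  have h2 := h.2.pow N
  refine IsSMulRegular.of_mul (a := u) ?_
  intro s t hst
  apply h2
  have key : ∀ s : R ⧸ (Ideal.ofList L • ⊤ : Submodule R R), y • s = 0 := by
    intro s
    obtain ⟨s, rfl⟩ := Submodule.Quotient.mk_surjective _ s
    rw [← Submodule.Quotient.mk_smul, Submodule.Quotient.mk_eq_zero]
    exact Submodule.smul_mem_smul hy trivial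
  simp only [← hyz, add_smul, key]
  simpa using hst

/-- In a Noetherian local ring whose maximal ideal is not minimal over `I` or `J`, some element of
the maximal ideal avoids all minimal primes of `I` and `J`. -/
theorem exists_mem_maximalIdeal_notMem_minimalPrimes {R : Type*} [CommRing R] [IsLocalRing R]
    [IsNoetherianRing R] {I J : Ideal R}
    (hI : IsLocalRing.maximalIdeal R ∉ I.minimalPrimes)
    (hJ : IsLocalRing.maximalIdeal R ∉ J.minimalPrimes) :
    ∃ y ∈ IsLocalRing.maximalIdeal R, (∀ P ∈ I.minimalPrimes, y ∉ P) ∧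
      ∀ P ∈ J.minimalPrimes, y ∉ P := by
  have hfin : (I.minimalPrimes ∪ J.minimalPrimes).Finite :=
    I.finite_minimalPrimes_of_isNoetherianRing.union J.finite_minimalPrimes_of_isNoetherianRing
  have hprime : ∀ P ∈ I.minimalPrimes ∪ J.minimalPrimes, P.IsPrime := by
    rintro P (h | h) <;> exact h.isPrime
  by_contra! hcon
  have hsub : (IsLocalRing.maximalIdeal R : Set R) ⊆
      ⋃ P ∈ (↑hfin.toFinset : Set (Ideal R)), (id P : Ideal R) := by
    intro y hy
    simp only [Set.Finite.coe_toFinset, Set.mem_iUnion, id, exists_prop]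
    by_cases h : ∀ P ∈ I.minimalPrimes, y ∉ P
    · obtain ⟨P, hP, hyP⟩ := hcon y hy h
      exact ⟨P, Or.inr hP, hyP⟩
    · push Not at h
      obtain ⟨P, hP, hyP⟩ := h
      exact ⟨P, Or.inl hP, hyP⟩
  obtain ⟨P, hP, hle⟩ := (Ideal.subset_union_prime (f := id) ⊤ ⊤
    (fun P hP _ _ => hprime P (hfin.mem_toFinset.mp hP))).mp hsub
  rw [hfin.mem_toFinset] at hP
  have hPm : IsLocalRing.maximalIdeal R = P :=
    (IsLocalRing.maximalIdeal.isMaximal R).eq_of_le (hprime P hP).ne_top hle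
  rcases hP with h | h
  · exact hI (hPm ▸ h)
  · exact hJ (hPm ▸ h)

/-- If `I` together with one element is primary to the maximal ideal, then the same holds for `I`
together with any `y` outside the minimal primes of `I`: by Krull's principal ideal theorem, there
is no room for a prime strictly between a minimal prime of `I` and the maximal ideal. -/
theorem maximalIdeal_le_radical_sup_span_of_notMem_minimalPrimes {R : Type*} [CommRing R]
    [IsLocalRing R] [IsNoetherianRing R] {I : Ideal R} {f y : R}
    (hf : f ∈ IsLocalRing.maximalIdeal R) (hIm : I ≤ IsLocalRing.maximalIdeal R)
    (h : IsLocalRing.maximalIdeal R ≤ (I ⊔ Ideal.span {f}).radical)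
    (hy : ∀ P ∈ I.minimalPrimes, y ∉ P) :
    IsLocalRing.maximalIdeal R ≤ (I ⊔ Ideal.span {y}).radical := by
  rw [Ideal.radical_eq_sInf, le_sInf_iff]
  rintro P ⟨hP, hPp⟩
  have hIP : I ≤ P := le_sup_left.trans hP
  have hyP : y ∈ P := hP (Ideal.mem_sup_right (Ideal.mem_span_singleton_self y))
  by_contra hlt
  have hPm : P < IsLocalRing.maximalIdeal R :=
    lt_of_le_not_ge (IsLocalRing.le_maximalIdeal hPp.ne_top) hlt
  have hspan : Ideal.span (insert f (I : Set R)) = I ⊔ Ideal.span {f} := by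
    rw [Ideal.span_insert, Ideal.span_eq, sup_comm]
  have hmin : P ∈ (Ideal.span (I : Set R)).minimalPrimes := by
    refine Ideal.mem_minimalPrimes_span_of_mem_minimalPrimes_span_insert hPm f (I : Set R) ?_
      (I : Set R) hIP ?_
    · rw [hspan]
      refine ⟨⟨inferInstance, sup_le hIm ((Ideal.span_singleton_le_iff_mem _).mpr hf)⟩, ?_⟩
      intro Q hQ _
      exact h.trans (hQ.1.isRadical.radical_le_iff.mpr hQ.2)
    · rw [hspan]
      exact fun x hx => Ideal.le_radical (Ideal.mem_sup_left hx)
  rw [Ideal.span_eq] at hmin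
  exact hy P hmin hyP

theorem maximalIdeal_notMem_minimalPrimes_ofList {R : Type*} [CommRing R] [IsLocalRing R]
    [IsNoetherianRing R] {L : List R}
    (h : (L.length : ℕ∞) < (IsLocalRing.maximalIdeal R).height) :
    IsLocalRing.maximalIdeal R ∉ (Ideal.ofList L).minimalPrimes := by
  classical
  intro hmem
  have hL : Ideal.ofList L = Ideal.span (L.toFinset : Set R) := by
    simp [Ideal.ofList]
  rw [hL] at hmem
  have h1 := Ideal.height_le_card_of_mem_minimalPrimes_span_finset hmem
  have h2 : (L.toFinset.card : ℕ∞) ≤ L.length := by exact_mod_cast L.toFinset_card_le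
  exact absurd (h1.trans h2) (not_le.mpr h)

theorem length_le_height_maximalIdeal_of_isRegular {R : Type*} [CommRing R] [IsLocalRing R]
    [IsNoetherianRing R] {L : List R} (h : RingTheory.Sequence.IsRegular R L) :
    (L.length : ℕ∞) ≤ (IsLocalRing.maximalIdeal R).height := by
  have h1 := ringKrullDim_add_length_eq_ringKrullDim_of_isRegular L h
  rw [← IsLocalRing.maximalIdeal_height_eq_ringKrullDim (R := R)] at h1
  have hnt : Nontrivial (R ⧸ Ideal.ofList L) := by
    refine Ideal.Quotient.nontrivial_iff.mpr fun htop => h.top_ne_smul ?_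
    rw [htop]; simp
  have h2 : (0 : WithBot ℕ∞) ≤ ringKrullDim (R ⧸ Ideal.ofList L) :=
    ringKrullDim_nonneg_of_nontrivial
  have h3 : ((L.length : ℕ∞) : WithBot ℕ∞) ≤
      ((IsLocalRing.maximalIdeal R).height : WithBot ℕ∞) := by
    rw [← h1]
    calc ((L.length : ℕ∞) : WithBot ℕ∞) = 0 + (L.length : WithBot ℕ∞) := by simp
      _ ≤ _ := by gcongr
  exact_mod_cast h3

open RingTheory.Sequence in
/-- Two systems of parameters with a common initial part `ys`: if one of them is a regular
sequence, so is the other. The remaining members are exchanged, one at a time, for general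
elements of the maximal ideal that serve both systems. -/
theorem isWeaklyRegular_append_of_isWeaklyRegular_append {R : Type*} [CommRing R] [IsLocalRing R]
    [IsNoetherianRing R] (fs : List R) : ∀ (ys xs : List R), fs.length = xs.length →
    ((ys ++ fs).length : ℕ∞) ≤ (IsLocalRing.maximalIdeal R).height →
    (∀ r ∈ ys ++ fs, r ∈ IsLocalRing.maximalIdeal R) →
    (∀ r ∈ ys ++ xs, r ∈ IsLocalRing.maximalIdeal R) →
    IsLocalRing.maximalIdeal R ≤ (Ideal.ofList (ys ++ fs)).radical →
    IsLocalRing.maximalIdeal R ≤ (Ideal.ofList (ys ++ xs)).radical →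
    IsWeaklyRegular R (ys ++ xs) → IsWeaklyRegular R (ys ++ fs) := by
  induction fs with
  | nil =>
    intro ys xs hlen _ _ _ _ _ hreg
    obtain rfl : xs = [] := List.length_eq_zero_iff.mp hlen.symm
    exact hreg
  | cons f fs ih =>
    intro ys xs hlen hht hfm hxm hfr hxr hreg
    obtain _ | ⟨x, xs⟩ := xs
    · simp at hlen
    have hlen' : fs.length = xs.length := by simpa using hlen
    have hperm : ∀ (a : R) (as : List R), (ys ++ a :: as).Perm ((ys ++ as) ++ [a]) := by
      intro a as
      rw [List.append_assoc]
      exact (List.perm_append_singleton a as).symm.append_left ys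
    have hofList : ∀ (a : R) (as : List R),
        Ideal.ofList (ys ++ a :: as) = Ideal.ofList (ys ++ as) ⊔ Ideal.span {a} := by
      intro a as
      simp only [Ideal.ofList_append, Ideal.ofList_cons]
      rw [sup_assoc, sup_comm (Ideal.span {a})]
    have hht1 : ((ys ++ fs).length : ℕ∞) < (IsLocalRing.maximalIdeal R).height := by
      refine lt_of_lt_of_le ?_ hht
      norm_cast
      simp
    have hht2 : ((ys ++ xs).length : ℕ∞) < (IsLocalRing.maximalIdeal R).height := by
      rwa [List.length_append, ← hlen', ← List.length_append]
    obtain ⟨y, hym, hyf, hyx⟩ := exists_mem_maximalIdeal_notMem_minimalPrimes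
      (maximalIdeal_notMem_minimalPrimes_ofList hht1)
      (maximalIdeal_notMem_minimalPrimes_ofList hht2)
    have hfm' : ∀ r ∈ ys ++ y :: fs, r ∈ IsLocalRing.maximalIdeal R := by
      intro r hr
      simp only [List.mem_append, List.mem_cons] at hr hfm
      grind
    have hxm' : ∀ r ∈ ys ++ y :: xs, r ∈ IsLocalRing.maximalIdeal R := by
      intro r hr
      simp only [List.mem_append, List.mem_cons] at hr hxm
      grind
    have hfr' : IsLocalRing.maximalIdeal R ≤ (Ideal.ofList (ys ++ y :: fs)).radical := by
      rw [hofList] at hfr ⊢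
      refine maximalIdeal_le_radical_sup_span_of_notMem_minimalPrimes (hfm f (by simp)) ?_ hfr hyf
      exact Ideal.span_le.mpr fun r hr => hfm r (by
        simp only [Set.mem_ofPred_eq, List.mem_append, List.mem_cons] at hr ⊢; tauto)
    have hxr' : IsLocalRing.maximalIdeal R ≤ (Ideal.ofList (ys ++ y :: xs)).radical := by
      rw [hofList] at hxr ⊢
      refine maximalIdeal_le_radical_sup_span_of_notMem_minimalPrimes (hxm x (by simp)) ?_ hxr hyx
      exact Ideal.span_le.mpr fun r hr => hxm r (by
        simp only [Set.mem_ofPred_eq, List.mem_append, List.mem_cons] at hr ⊢; tauto)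
    -- replacing one member `a` of a regular sequence by `b`
    have exchange : ∀ (a b : R) (as : List R), a ∈ IsLocalRing.maximalIdeal R →
        (∀ r ∈ ys ++ a :: as, r ∈ IsLocalRing.maximalIdeal R) →
        (∀ r ∈ ys ++ b :: as, r ∈ IsLocalRing.maximalIdeal R) →
        IsLocalRing.maximalIdeal R ≤ (Ideal.ofList (ys ++ b :: as)).radical →
        IsWeaklyRegular R (ys ++ a :: as) → IsWeaklyRegular R (ys ++ b :: as) := by
      intro a b as ha h1 h2 hr hreg
      have h3 := IsLocalRing.isWeaklyRegular_of_perm_of_subset_maximalIdeal hreg (hperm a as) h1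
      have h4 : IsWeaklyRegular R ((ys ++ as) ++ [b]) := by
        refine isWeaklyRegular_concat_of_mem_radical h3 ?_
        have := hr ha
        rwa [hofList, ← Ideal.ofList_singleton, ← Ideal.ofList_append] at this
      exact IsLocalRing.isWeaklyRegular_of_perm_of_subset_maximalIdeal h4 (hperm b as).symm
        fun r hr => h2 r ((hperm b as).mem_iff.mpr hr)
    have hregx : IsWeaklyRegular R (ys ++ y :: xs) :=
      exchange x y xs (hxm x (by simp)) hxm hxm' hxr' hreg
    have hregf : IsWeaklyRegular R (ys ++ y :: fs) := by
      have := ih (ys ++ [y]) xs hlen'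
      simp only [List.append_assoc, List.singleton_append] at this
      exact this (by simpa using hht) hfm' hxm' hfr' hxr' hregx
    exact exchange y f fs hym hfm' hfm hfr hregf

/-- In a Noetherian local ring, if one system of parameters is a regular sequence, then so is
every system of parameters. -/
theorem isWeaklyRegular_of_isRegular_of_length_eq {R : Type*} [CommRing R] [IsLocalRing R]
    [IsNoetherianRing R] {fs xs : List R} (hlen : fs.length = xs.length)
    (hxs : RingTheory.Sequence.IsRegular R xs)
    (hfm : ∀ r ∈ fs, r ∈ IsLocalRing.maximalIdeal R)
    (hxm : ∀ r ∈ xs, r ∈ IsLocalRing.maximalIdeal R)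
    (hfr : IsLocalRing.maximalIdeal R ≤ (Ideal.ofList fs).radical)
    (hxr : IsLocalRing.maximalIdeal R ≤ (Ideal.ofList xs).radical) :
    RingTheory.Sequence.IsWeaklyRegular R fs :=
  isWeaklyRegular_append_of_isWeaklyRegular_append fs [] xs hlen
    (by simpa [hlen] using length_le_height_maximalIdeal_of_isRegular hxs) hfm hxm hfr hxr
    hxs.toIsWeaklyRegular

/-! ### Hilbert functions and Macaulay's theorem -/

attribute [local instance] MvPolynomial.gradedAlgebra

namespace MvPolynomial

theorem homogeneousComponent_mul_of_isHomogeneous {σ R : Type*} [CommSemiring R]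
    {f : MvPolynomial σ R} {e : ℕ} (hf : f.IsHomogeneous e) (q : MvPolynomial σ R) (u : ℕ) :
    homogeneousComponent (u + e) (q * f) = homogeneousComponent u q * f := by
  have := DirectSum.coe_decompose_mul_add_of_right_mem (homogeneousSubmodule σ R)
    (a := q) (b := f) (i := u) (j := e) hf
  rwa [← decomposition.decompose'_apply, ← decomposition.decompose'_apply]

theorem homogeneousComponent_mul_of_isHomogeneous_of_lt {σ R : Type*} [CommSemiring R]
    {f : MvPolynomial σ R} {e : ℕ} (hf : f.IsHomogeneous e) (q : MvPolynomial σ R) {t : ℕ}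
    (ht : t < e) : homogeneousComponent t (q * f) = 0 := by
  have := DirectSum.coe_decompose_mul_of_right_mem_of_not_le (homogeneousSubmodule σ R)
    (a := q) (b := f) (i := e) (n := t) hf (not_le.mpr ht)
  rwa [← decomposition.decompose'_apply]

/-- The forms of degree `t` in the ideal `I`, as a vector space over the base field. -/
noncomputable def idealPart {σ k : Type*} [Field k] (I : Ideal (MvPolynomial σ k)) (t : ℕ) :
    Submodule k (MvPolynomial σ k) :=
  I.restrictScalars k ⊓ homogeneousSubmodule σ k t

theorem mem_idealPart {σ k : Type*} [Field k] {I : Ideal (MvPolynomial σ k)} {t : ℕ}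
    {p : MvPolynomial σ k} : p ∈ idealPart I t ↔ p ∈ I ∧ p.IsHomogeneous t := Iff.rfl

instance {σ k : Type*} [Finite σ] [Field k] (t : ℕ) :
    FiniteDimensional k (homogeneousSubmodule σ k t) :=
  Module.Finite.iff_fg.mpr (homogeneousSubmodule_fg σ k t)

instance {σ k : Type*} [Finite σ] [Field k] (I : Ideal (MvPolynomial σ k)) (t : ℕ) :
    FiniteDimensional k (idealPart I t) :=
  Submodule.finiteDimensional_inf_right _ _

theorem idealPart_sup_span_of_lt {σ k : Type*} [Field k] {I : Ideal (MvPolynomial σ k)}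
    (hI : I.IsHomogeneous (homogeneousSubmodule σ k)) {f : MvPolynomial σ k} {e t : ℕ}
    (hf : f.IsHomogeneous e) (ht : t < e) :
    idealPart (I ⊔ Ideal.span {f}) t = idealPart I t := by
  refine le_antisymm (fun p hp => ?_) fun p hp => ⟨Ideal.mem_sup_left hp.1, hp.2⟩
  obtain ⟨hp, hpt⟩ := mem_idealPart.mp hp
  obtain ⟨a, ha, b, hb, rfl⟩ := Submodule.mem_sup.mp hp
  obtain ⟨q, rfl⟩ := Ideal.mem_span_singleton'.mp hb
  refine mem_idealPart.mpr ⟨?_, hpt⟩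
  have h := homogeneousComponent_eq_self hpt
  rw [map_add, homogeneousComponent_mul_of_isHomogeneous_of_lt hf q ht, add_zero] at h
  rw [← h]
  exact homogeneousComponent_mem_of_mem hI ha t

/-- Adding a form that is a nonzerodivisor modulo `I` changes the dimensions of the graded parts
in a way that depends only on the degree of the form. -/
theorem finrank_idealPart_sup_span {σ k : Type*} [Finite σ] [Field k]
    {I : Ideal (MvPolynomial σ k)}
    (hI : I.IsHomogeneous (homogeneousSubmodule σ k)) {f : MvPolynomial σ k} {e : ℕ}
    (hf : f.IsHomogeneous e) (hf0 : f ≠ 0)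
    (hreg : ∀ (t : ℕ) (z : MvPolynomial σ k), z.IsHomogeneous t → z * f ∈ I → z ∈ I) (u : ℕ) :
    Module.finrank k (idealPart (I ⊔ Ideal.span {f}) (u + e)) + Module.finrank k (idealPart I u) =
      Module.finrank k (idealPart I (u + e)) +
        Module.finrank k (homogeneousSubmodule σ k u) := by
  set μ : MvPolynomial σ k →ₗ[k] MvPolynomial σ k := LinearMap.mulRight k f with hμ
  have hinj : Function.Injective μ := fun a b hab => mul_right_cancel₀ hf0 hab
  have hsup : idealPart (I ⊔ Ideal.span {f}) (u + e) =
      idealPart I (u + e) ⊔ (homogeneousSubmodule σ k u).map μ := by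
    apply le_antisymm
    · intro p hp
      obtain ⟨hp, hpt⟩ := mem_idealPart.mp hp
      obtain ⟨a, ha, b, hb, rfl⟩ := Submodule.mem_sup.mp hp
      obtain ⟨q, rfl⟩ := Ideal.mem_span_singleton'.mp hb
      have h := homogeneousComponent_eq_self hpt
      rw [map_add, homogeneousComponent_mul_of_isHomogeneous hf q] at h
      rw [← h]
      exact Submodule.add_mem_sup
        ⟨homogeneousComponent_mem_of_mem hI ha _, homogeneousComponent_isHomogeneous _ _⟩
        ⟨_, homogeneousComponent_isHomogeneous u q, rfl⟩
    · refine sup_le (fun p hp => ⟨Ideal.mem_sup_left hp.1, hp.2⟩) ?_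
      rintro _ ⟨q, hq, rfl⟩
      exact ⟨Ideal.mem_sup_right (Ideal.mem_span_singleton'.mpr ⟨q, rfl⟩),
        IsHomogeneous.mul hq hf⟩
  have hinf : idealPart I (u + e) ⊓ (homogeneousSubmodule σ k u).map μ =
      (idealPart I u).map μ := by
    apply le_antisymm
    · rintro _ ⟨hp, q, hq, rfl⟩
      exact ⟨q, ⟨hreg u q hq hp.1, hq⟩, rfl⟩
    · rintro _ ⟨q, hq, rfl⟩
      exact ⟨⟨I.mul_mem_right _ hq.1, IsHomogeneous.mul hq.2 hf⟩, q, hq.2, rfl⟩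
  have h := Submodule.finrank_sup_add_finrank_inf_eq (idealPart I (u + e))
    ((homogeneousSubmodule σ k u).map μ)
  rwa [← hsup, hinf, ← (Submodule.equivMapOfInjective μ hinj _).finrank_eq,
    ← (Submodule.equivMapOfInjective μ hinj _).finrank_eq] at h

theorem isHomogeneous_span_image {σ k ι : Type*} [Field k] {f : ι → MvPolynomial σ k} {d : ι → ℕ}
    (hf : ∀ i, (f i).IsHomogeneous (d i)) (s : Set ι) :
    (Ideal.span (f '' s)).IsHomogeneous (homogeneousSubmodule σ k) := by
  refine Ideal.homogeneous_span _ _ ?_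
  rintro _ ⟨i, _, rfl⟩
  exact ⟨d i, hf i⟩

theorem span_image_ne_top {σ k ι : Type*} [Field k] {f : ι → MvPolynomial σ k} {d : ι → ℕ}
    (hf : ∀ i, (f i).IsHomogeneous (d i)) (hd : ∀ i, 0 < d i) (s : Set ι) :
    Ideal.span (f '' s) ≠ ⊤ := by
  have hle : Ideal.span (f '' s) ≤ RingHom.ker (constantCoeff (σ := σ) (R := k)) := by
    refine Ideal.span_le.mpr ?_
    rintro _ ⟨i, _, rfl⟩
    refine (hf i).coeff_eq_zero ?_
    simpa using (hd i).ne
  intro htop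
  have h1 := hle (htop ▸ Submodule.mem_top : (1 : MvPolynomial σ k) ∈ _)
  simp [RingHom.mem_ker] at h1

theorem image_lt_succ_eq_union {m : ℕ} {α : Type*} (f : Fin m → α) {j : ℕ} (hj : j < m) :
    f '' {i | (i : ℕ) < j + 1} = f '' {i | (i : ℕ) < j} ∪ {f ⟨j, hj⟩} := by
  rw [← Set.image_singleton, ← Set.image_union]
  congr 1
  ext i
  simp [Fin.ext_iff]
  omega

/-- Two homogeneous regular sequences with the same degrees generate ideals with the same Hilbert
function. -/
theorem finrank_idealPart_span_eq {m : ℕ} {σ k : Type*} [Finite σ] [Field k]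
    {f g : Fin m → MvPolynomial σ k} {d : Fin m → ℕ} (hd : ∀ i, 0 < d i)
    (hf : ∀ i, (f i).IsHomogeneous (d i)) (hg : ∀ i, (g i).IsHomogeneous (d i))
    (hfreg : ∀ (i : Fin m) (t : ℕ) (z : MvPolynomial σ k), z.IsHomogeneous t →
      z * f i ∈ Ideal.span (f '' {j | (j : ℕ) < i}) → z ∈ Ideal.span (f '' {j | (j : ℕ) < i}))
    (hgreg : ∀ (i : Fin m) (t : ℕ) (z : MvPolynomial σ k), z.IsHomogeneous t →
      z * g i ∈ Ideal.span (g '' {j | (j : ℕ) < i}) → z ∈ Ideal.span (g '' {j | (j : ℕ) < i}))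
    (j : ℕ) (hj : j ≤ m) (t : ℕ) :
    Module.finrank k (idealPart (Ideal.span (f '' {i | (i : ℕ) < j})) t) =
      Module.finrank k (idealPart (Ideal.span (g '' {i | (i : ℕ) < j})) t) := by
  induction j generalizing t with
  | zero =>
    have h0 : {i : Fin m | (i : ℕ) < 0} = ∅ := by ext; simp
    rw [h0, Set.image_empty, Set.image_empty]
  | succ j ih =>
    have hj' : j < m := hj
    have ne_zero : ∀ h : Fin m → MvPolynomial σ k, (∀ i, (h i).IsHomogeneous (d i)) →
        (∀ (i : Fin m) (t : ℕ) (z : MvPolynomial σ k), z.IsHomogeneous t →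
          z * h i ∈ Ideal.span (h '' {j | (j : ℕ) < i}) →
          z ∈ Ideal.span (h '' {j | (j : ℕ) < i})) → h ⟨j, hj'⟩ ≠ 0 := by
      intro h hh hreg h0
      refine span_image_ne_top hh hd {i | (i : ℕ) < j} ((Ideal.eq_top_iff_one _).mpr ?_)
      exact hreg ⟨j, hj'⟩ 0 1 (isHomogeneous_one _ _) (by simp [h0])
    rw [image_lt_succ_eq_union f hj', image_lt_succ_eq_union g hj', Ideal.span_union,
      Ideal.span_union]
    have hIf := isHomogeneous_span_image hf {i | (i : ℕ) < j}
    have hIg := isHomogeneous_span_image hg {i | (i : ℕ) < j}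
    rcases lt_or_ge t (d ⟨j, hj'⟩) with ht | ht
    · rw [idealPart_sup_span_of_lt hIf (hf _) ht, idealPart_sup_span_of_lt hIg (hg _) ht]
      exact ih hj'.le t
    · obtain ⟨u, rfl⟩ := Nat.exists_eq_add_of_le' ht
      have h1 := finrank_idealPart_sup_span hIf (hf _) (ne_zero f hf hfreg) (hfreg ⟨j, hj'⟩) u
      have h2 := finrank_idealPart_sup_span hIg (hg _) (ne_zero g hg hgreg) (hgreg ⟨j, hj'⟩) u
      have h3 := ih hj'.le u
      have h4 := ih hj'.le (u + d ⟨j, hj'⟩)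
      omega

theorem ofList_take_ofFn {R : Type*} [CommSemiring R] {m : ℕ} (f : Fin m → R) (j : ℕ) :
    Ideal.ofList ((List.ofFn f).take j) = Ideal.span (f '' {i | (i : ℕ) < j}) := by
  unfold Ideal.ofList
  congr 1
  ext x
  simp only [Set.mem_ofPred_eq, Set.mem_image, List.mem_take_iff_getElem, List.getElem_ofFn,
    List.length_ofFn]
  constructor
  · rintro ⟨i, hi, rfl⟩
    exact ⟨⟨i, by omega⟩, by simp; omega, rfl⟩
  · rintro ⟨i, hi, rfl⟩
    exact ⟨i, by omega, rfl⟩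

theorem ofList_ofFn {R : Type*} [CommSemiring R] {m : ℕ} (f : Fin m → R) :
    Ideal.ofList (List.ofFn f) = Ideal.span (Set.range f) := by
  simp [Ideal.ofList, List.mem_ofFn, Set.range, eq_comm]

theorem isWeaklyRegular_ofFn_iff {R : Type*} [CommRing R] {m : ℕ} (f : Fin m → R) :
    RingTheory.Sequence.IsWeaklyRegular R (List.ofFn f) ↔
      ∀ (i : Fin m) (z : R), z * f i ∈ Ideal.span (f '' {j | (j : ℕ) < i}) →
        z ∈ Ideal.span (f '' {j | (j : ℕ) < i}) := by
  rw [RingTheory.Sequence.isWeaklyRegular_iff]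
  constructor
  · intro h i z hz
    have := h i (by simp)
    rw [isSMulRegular_quotient_iff_mem_of_smul_mem, ofList_take_ofFn] at this
    simpa using this z (by simpa [mul_comm] using hz)
  · intro h i hi
    rw [isSMulRegular_quotient_iff_mem_of_smul_mem, ofList_take_ofFn]
    intro z hz
    have := h ⟨i, by simpa using hi⟩ z
    simp only [smul_eq_mul, Ideal.mul_top, List.getElem_ofFn] at hz ⊢
    exact this (by simpa [mul_comm] using hz)

theorem isWeaklyRegular_X {m : ℕ} (k : Type*) [Field k] :
    RingTheory.Sequence.IsWeaklyRegular (MvPolynomial (Fin m) k) 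
      (List.ofFn (X : Fin m → MvPolynomial (Fin m) k)) := by
  rw [isWeaklyRegular_ofFn_iff]
  intro i z hz
  rw [mem_ideal_span_X_image] at hz ⊢
  intro s hs
  have h1 : s + Finsupp.single i 1 ∈ (z * X i).support := by
    rw [mem_support_iff, coeff_mul_X]
    exact mem_support_iff.mp hs
  obtain ⟨j, hj, hne⟩ := hz _ h1
  refine ⟨j, hj, ?_⟩
  have hij : i ≠ j := by
    rintro rfl
    exact lt_irrefl (i : ℕ) hj
  simpa [Finsupp.single_apply, hij] using hne

/-- If the variables are nilpotent modulo `m` forms of positive degree in `m` variables, then the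
forms are a regular sequence (stated for homogeneous multipliers `z`, which is all that the Hilbert
function needs): they are one in the local ring at the origin, where they are a system of
parameters like the variables, and modulo homogeneous ideals nothing homogeneous is lost there. -/
theorem isWeaklyRegular_of_X_mem_radical {m : ℕ} {k : Type*} [Field k]
    {f : Fin m → MvPolynomial (Fin m) k} {d : Fin m → ℕ}
    (hd : ∀ i, 0 < d i) (hf : ∀ i, (f i).IsHomogeneous (d i))
    (hX : ∀ i, X i ∈ (Ideal.span (Set.range f)).radical)
    (i : Fin m) (t : ℕ) (z : MvPolynomial (Fin m) k) (hz : z.IsHomogeneous t)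
    (hzf : z * f i ∈ Ideal.span (f '' {j | (j : ℕ) < i})) :
    z ∈ Ideal.span (f '' {j | (j : ℕ) < i}) := by
  set 𝔪 : Ideal (MvPolynomial (Fin m) k) :=
    RingHom.ker (constantCoeff (σ := Fin m) (R := k)) with h𝔪
  have hprime : 𝔪.IsPrime := RingHom.ker_isPrime _
  have hspan : 𝔪 = Ideal.span (Set.range X) := by
    apply le_antisymm
    · intro p hp
      rw [← Set.image_univ, mem_ideal_span_X_image]
      intro s hs
      by_contra! hcon
      have : s = 0 := Finsupp.ext fun i => hcon i trivial
      subst this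
      exact mem_support_iff.mp hs hp
    · refine Ideal.span_le.mpr ?_
      rintro _ ⟨j, rfl⟩
      simp [h𝔪, RingHom.mem_ker]
  have hfm : ∀ j, f j ∈ 𝔪 := fun j => by
    change coeff 0 (f j) = 0
    exact (hf j).coeff_eq_zero (by simpa using (hd j).ne)
  set R := Localization.AtPrime 𝔪
  have hmax : IsLocalRing.maximalIdeal R = 𝔪.map (algebraMap _ R) :=
    (Localization.AtPrime.map_eq_maximalIdeal).symm
  have hmem : ∀ a ∈ 𝔪, algebraMap _ R a ∈ IsLocalRing.maximalIdeal R := fun a ha => by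
    rw [hmax]; exact Ideal.mem_map_of_mem _ ha
  have hofList : ∀ g : Fin m → MvPolynomial (Fin m) k,
      Ideal.ofList ((List.ofFn g).map (algebraMap _ R)) =
      (Ideal.span (Set.range g)).map (algebraMap _ R) := by
    intro g
    rw [← Ideal.map_ofList, ofList_ofFn]
  have hrad : ∀ g : Fin m → MvPolynomial (Fin m) k, 𝔪 ≤ (Ideal.span (Set.range g)).radical →
      IsLocalRing.maximalIdeal R ≤
        (Ideal.ofList ((List.ofFn g).map (algebraMap _ R))).radical := by
    intro g hg
    rw [hofList, hmax]
    exact (Ideal.map_mono hg).trans (Ideal.map_radical_le _)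
  have hxm : ∀ r ∈ (List.ofFn (X : Fin m → MvPolynomial (Fin m) k)).map (algebraMap _ R),
      r ∈ IsLocalRing.maximalIdeal R := by
    simp only [List.mem_map, List.mem_ofFn]
    rintro _ ⟨_, ⟨j, rfl⟩, rfl⟩
    exact hmem _ (by simp [h𝔪, RingHom.mem_ker])
  have hreg : RingTheory.Sequence.IsWeaklyRegular R ((List.ofFn f).map (algebraMap _ R)) := by
    refine isWeaklyRegular_of_isRegular_of_length_eq
      (xs := (List.ofFn (X : Fin m → MvPolynomial (Fin m) k)).map (algebraMap _ R))
      (by simp) ?_ ?_ hxm ?_ ?_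
    · exact RingTheory.Sequence.IsRegular.of_isWeaklyRegular_of_mem_maximalIdeal R hxm
        ((isWeaklyRegular_X k).of_isLocalization R 𝔪.primeCompl)
    · simp only [List.mem_map, List.mem_ofFn]
      rintro _ ⟨_, ⟨j, rfl⟩, rfl⟩
      exact hmem _ (hfm j)
    · refine hrad f ?_
      rw [hspan]
      refine Ideal.span_le.mpr ?_
      rintro _ ⟨j, rfl⟩
      exact hX j
    · exact hrad X (hspan.le.trans Ideal.le_radical)
  rw [List.map_ofFn, isWeaklyRegular_ofFn_iff] at hreg
  have hI : ∀ j : ℕ, Ideal.span ((algebraMap _ R ∘ f) '' {i | (i : ℕ) < j}) =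
      (Ideal.span (f '' {i | (i : ℕ) < j})).map (algebraMap _ R) := by
    intro j
    rw [Ideal.map_span, Set.image_comp]
  have hloc : algebraMap _ R z ∈ (Ideal.span (f '' {j | (j : ℕ) < i})).map (algebraMap _ R) := by
    rw [← hI]
    refine hreg i _ ?_
    rw [hI, Function.comp_apply, ← map_mul]
    exact Ideal.mem_map_of_mem _ hzf
  rw [IsLocalization.algebraMap_mem_map_algebraMap_iff 𝔪.primeCompl] at hloc
  obtain ⟨s, hs, hsz⟩ := hloc
  -- the degree `t` part of `s * z` is a nonzero constant times `z`
  have h1 := homogeneousComponent_mem_of_mem (isHomogeneous_span_image hf {j | (j : ℕ) < i}) hsz t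
  have h2 := homogeneousComponent_mul_of_isHomogeneous hz s 0
  rw [zero_add] at h2
  rw [h2, homogeneousComponent_zero] at h1
  have hs0 : coeff 0 s ≠ 0 := hs
  have h3 := Ideal.mul_mem_left _ (C (coeff 0 s)⁻¹) h1
  rwa [← mul_assoc, ← map_mul, inv_mul_cancel₀ hs0, map_one, one_mul] at h3

/-- **Macaulay's theorem**: if `m` forms of degrees `d i > 0` in `m` variables have no common zero
besides the origin, then they generate all forms of degree larger than `∑ i, (d i - 1)`. The
Hilbert function of the ideal is the one for `X i ^ d i`, where the claim is clear. -/
theorem mem_span_range_of_isHomogeneous {m : ℕ} {k : Type*} [Field k]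
    {f : Fin m → MvPolynomial (Fin m) k} {d : Fin m → ℕ}
    (hd : ∀ i, 0 < d i) (hf : ∀ i, (f i).IsHomogeneous (d i))
    (hX : ∀ i, X i ∈ (Ideal.span (Set.range f)).radical)
    {D : ℕ} (hD : ∑ i, (d i - 1) < D) {p : MvPolynomial (Fin m) k} (hp : p.IsHomogeneous D) :
    p ∈ Ideal.span (Set.range f) := by
  set g : Fin m → MvPolynomial (Fin m) k := fun i => X i ^ d i with hgdef
  have hg : ∀ i, (g i).IsHomogeneous (d i) := fun i => by
    simpa using (isHomogeneous_X k i).pow (d i)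
  have hgX : ∀ i, X i ∈ (Ideal.span (Set.range g)).radical :=
    fun i => ⟨d i, Ideal.subset_span ⟨i, rfl⟩⟩
  have huniv : {i : Fin m | (i : ℕ) < m} = Set.univ := by ext i; simp
  have hdim := finrank_idealPart_span_eq hd hf hg (isWeaklyRegular_of_X_mem_radical hd hf hX)
    (isWeaklyRegular_of_X_mem_radical hd hg hgX) m le_rfl D
  rw [huniv, Set.image_univ, Set.image_univ] at hdim
  have hgD : idealPart (Ideal.span (Set.range g)) D = homogeneousSubmodule (Fin m) k D := by
    refine le_antisymm inf_le_right fun q hq => ⟨?_, hq⟩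
    have hrange : Set.range g =
        (fun s => monomial s (1 : k)) '' Set.range fun i => Finsupp.single i (d i) := by
      rw [← Set.range_comp]
      congr 1
      funext i
      simp [hgdef, X_pow_eq_monomial]
    change q ∈ Ideal.span (Set.range g)
    rw [hrange, mem_ideal_span_monomial_image]
    intro s hs
    -- a monomial outside this ideal has degree at most `∑ i, (d i - 1)`
    by_contra! hcon
    have hlt : ∀ i, s i ≤ d i - 1 := by
      intro i
      have := hcon _ ⟨i, rfl⟩
      rw [Finsupp.single_le_iff] at this
      omega
    have hdeg : s.degree = D := by
      have := hq (mem_support_iff.mp hs)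
      rwa [Finsupp.degree_eq_weight_one]
    have : s.degree ≤ ∑ i, (d i - 1) := by
      rw [Finsupp.degree_eq_sum]
      exact Finset.sum_le_sum fun i _ => hlt i
    omega
  rw [hgD] at hdim
  have heq := Submodule.eq_of_le_of_finrank_eq
    (show idealPart (Ideal.span (Set.range f)) D ≤ _ from inf_le_right) hdim
  have : p ∈ idealPart (Ideal.span (Set.range f)) D := by rw [heq]; exact hp
  exact this.1

end MvPolynomial

/-! ### The Macaulay matrix -/

theorem Matrix.abs_det_le_factorial_mul_prod {n : Type*} [Fintype n] [DecidableEq n]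
    {A : Matrix n n ℤ} {b : n → ℤ} (h : ∀ i j, |A i j| ≤ b i) :
    |A.det| ≤ (Fintype.card n).factorial * ∏ i, b i := by
  rw [← Matrix.det_transpose, Matrix.det_apply]
  calc |∑ σ : Equiv.Perm n, Equiv.Perm.sign σ • ∏ i, A.transpose (σ i) i|
      ≤ ∑ σ : Equiv.Perm n, |Equiv.Perm.sign σ • ∏ i, A.transpose (σ i) i| :=
        Finset.abs_sum_le_sum_abs _ _
    _ ≤ ∑ _σ : Equiv.Perm n, ∏ i, b i := by
        refine Finset.sum_le_sum fun σ _ => ?_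
        rw [Units.smul_def, smul_eq_mul, abs_mul, Int.isUnit_iff_abs_eq.mp (Units.isUnit _),
          one_mul, Finset.abs_prod]
        exact Finset.prod_le_prod (fun _ _ => abs_nonneg _) fun i _ => h i (σ i)
    _ = _ := by simp [Fintype.card_perm]

namespace MvPolynomial

/-- The exponents of the monomials of degree `t` in `m` variables. -/
abbrev DegMonomial (m t : ℕ) : Type :=
  {s : Fin m →₀ ℕ // s ∈ Finset.univ.finsuppAntidiag t}

theorem mem_finsuppAntidiag_univ_iff {m t : ℕ} {s : Fin m →₀ ℕ} :
    s ∈ Finset.univ.finsuppAntidiag t ↔ s.degree = t := by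
  simp [Finset.mem_finsuppAntidiag, Finsupp.degree_eq_sum]

theorem card_degMonomial (m t : ℕ) : Fintype.card (DegMonomial m t) = (m + t - 1).choose t := by
  simp [Finset.card_finsuppAntidiag_nat_eq_choose]

theorem IsHomogeneous.eq_sum_degMonomial {R : Type*} [CommSemiring R] {m t : ℕ}
    {p : MvPolynomial (Fin m) R} (hp : p.IsHomogeneous t) :
    p = ∑ s : DegMonomial m t, monomial s.1 (coeff s.1 p) := by
  classical
  ext s
  rw [coeff_sum]
  simp only [coeff_monomial]
  by_cases hs : s.degree = t
  · rw [Finset.sum_eq_single ⟨s, mem_finsuppAntidiag_univ_iff.mpr hs⟩]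
    · simp
    · rintro ⟨s', hs'⟩ _ hne
      exact if_neg fun h => hne (Subtype.ext h)
    · simp
  · rw [hp.coeff_eq_zero hs, eq_comm]
    refine Finset.sum_eq_zero fun s' _ => if_neg ?_
    rintro rfl
    exact hs (mem_finsuppAntidiag_univ_iff.mp s'.2)

/-- The indices of the rows of the Macaulay matrix in degree `D` of forms of degrees `d i`: the
pair `(i, s)` stands for the product of the monomial `X ^ s` and the `i`-th form. -/
abbrev MacaulayRow {m : ℕ} (d : Fin m → ℕ) (D : ℕ) : Type :=
  Σ i : Fin m, DegMonomial m (D - d i)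

/-- The rows of the Macaulay matrix, as polynomials. -/
noncomputable def macaulayRow {R : Type*} [CommSemiring R] {m : ℕ}
    (f : Fin m → MvPolynomial (Fin m) R) (d : Fin m → ℕ) (D : ℕ) (r : MacaulayRow d D) :
    MvPolynomial (Fin m) R :=
  monomial r.2.1 1 * f r.1

theorem isHomogeneous_macaulayRow {R : Type*} [CommSemiring R] {m : ℕ}
    {f : Fin m → MvPolynomial (Fin m) R} {d : Fin m → ℕ} (hf : ∀ i, (f i).IsHomogeneous (d i))
    {D : ℕ} (hD : ∀ i, d i ≤ D) (r : MacaulayRow d D) :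
    (macaulayRow f d D r).IsHomogeneous D := by
  have h := (isHomogeneous_monomial (1 : R)
    (mem_finsuppAntidiag_univ_iff.mp r.2.2)).mul (hf r.1)
  rwa [Nat.sub_add_cancel (hD r.1)] at h

theorem map_macaulayRow {R S : Type*} [CommSemiring R] [CommSemiring S] (φ : R →+* S) {m : ℕ}
    (f : Fin m → MvPolynomial (Fin m) R) (d : Fin m → ℕ) (D : ℕ) (r : MacaulayRow d D) :
    map φ (macaulayRow f d D r) = macaulayRow (fun i => map φ (f i)) d D r := by
  simp [macaulayRow]

/-- The linear map sending a polynomial to its coefficients in degree `D`. -/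
noncomputable def degCoeff (k : Type*) [CommSemiring k] (m D : ℕ) :
    MvPolynomial (Fin m) k →ₗ[k] (DegMonomial m D → k) :=
  LinearMap.pi fun s => lcoeff k s.1

theorem degCoeff_apply {k : Type*} [CommSemiring k] {m D : ℕ} (p : MvPolynomial (Fin m) k)
    (s : DegMonomial m D) : degCoeff k m D p s = coeff s.1 p := rfl

/-- If the variables are nilpotent modulo the forms `f i`, then their Macaulay matrix in a degree
above `∑ i, (d i - 1)` has full column rank. -/
theorem span_range_degCoeff_macaulayRow {k : Type*} [Field k] {m : ℕ}
    {f : Fin m → MvPolynomial (Fin m) k} {d : Fin m → ℕ} (hd : ∀ i, 0 < d i)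
    (hf : ∀ i, (f i).IsHomogeneous (d i))
    (hX : ∀ i, X i ∈ (Ideal.span (Set.range f)).radical)
    {D : ℕ} (hD : ∑ i, (d i - 1) < D) (hdD : ∀ i, d i ≤ D) :
    Submodule.span k (Set.range fun r => degCoeff k m D (macaulayRow f d D r)) = ⊤ := by
  classical
  rw [eq_top_iff]
  rintro w -
  set p : MvPolynomial (Fin m) k := ∑ s : DegMonomial m D, monomial s.1 (w s) with hpdef
  have hp : p.IsHomogeneous D := IsHomogeneous.sum _ _ _ fun s _ =>
    isHomogeneous_monomial _ (mem_finsuppAntidiag_univ_iff.mp s.2)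
  have hpw : degCoeff k m D p = w := by
    funext s
    rw [degCoeff_apply, hpdef, coeff_sum, Finset.sum_eq_single s]
    · simp
    · intro s' _ hne
      rw [coeff_monomial, if_neg fun h => hne (Subtype.ext h)]
    · simp
  have hmem := mem_span_range_of_isHomogeneous hd hf hX hD hp
  obtain ⟨c, hc⟩ := Ideal.mem_span_range_iff_exists_fun.mp hmem
  have hpc : p = ∑ i, homogeneousComponent (D - d i) (c i) * f i := by
    rw [← homogeneousComponent_eq_self hp, ← hc, map_sum]
    refine Finset.sum_congr rfl fun i _ => ?_
    have := homogeneousComponent_mul_of_isHomogeneous (hf i) (c i) (D - d i)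
    rwa [Nat.sub_add_cancel (hdD i)] at this
  have hps : p ∈ Submodule.span k (Set.range (macaulayRow f d D)) := by
    rw [hpc]
    refine Submodule.sum_mem _ fun i _ => ?_
    rw [(homogeneousComponent_isHomogeneous (D - d i) (c i)).eq_sum_degMonomial, Finset.sum_mul]
    refine Submodule.sum_mem _ fun s _ => ?_
    set a := coeff s.1 (homogeneousComponent (D - d i) (c i))
    have : monomial s.1 a * f i = a • macaulayRow f d D ⟨i, s⟩ := by
      rw [macaulayRow, ← smul_mul_assoc, smul_monomial, smul_eq_mul, mul_one]
    rw [this]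
    exact Submodule.smul_mem _ _ (Submodule.subset_span ⟨_, rfl⟩)
  have := Submodule.mem_map_of_mem (f := degCoeff k m D) hps
  rwa [Submodule.map_span, ← Set.range_comp, hpw] at this

/-- By the Nullstellensatz, the variables are nilpotent modulo polynomials whose only common zero is
the origin. -/
theorem X_mem_radical_of_forall_eq_zero {k : Type*} [Field k] [IsAlgClosed k] {m : ℕ}
    {f : Fin m → MvPolynomial (Fin m) k}
    (h : ∀ a : Fin m → k, (∀ i, eval a (f i) = 0) → a = 0) (i : Fin m) :
    X i ∈ (Ideal.span (Set.range f)).radical := by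
  rw [← vanishingIdeal_zeroLocus_eq_radical (k := k) (K := k)]
  rw [mem_vanishingIdeal_iff]
  intro a ha
  rw [mem_zeroLocus_iff] at ha
  have h0 := h a fun i => by
    simpa [aeval_eq_eval] using ha (f i) (Ideal.subset_span ⟨i, rfl⟩)
  simp [h0]

/-- Forms with integer coefficients without a common zero in characteristic zero have a nonzero
maximal minor of their Macaulay matrix. If they acquire a common zero in characteristic `p`, then
`p` divides this minor, and hence is bounded by its size. -/
theorem prime_le_of_forall_eq_zero_of_exists_ne_zero {m : ℕ} {F : Fin m → MvPolynomial (Fin m) ℤ}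
    {d : Fin m → ℕ} (hd : ∀ i, 0 < d i) (hF : ∀ i, (F i).IsHomogeneous (d i))
    {B : Fin m → ℕ} (hB : ∀ i, 0 < B i) (hFB : ∀ i s, |coeff s (F i)| ≤ B i)
    {L : Type*} [Field L] [IsAlgClosed L] [CharZero L]
    (hL : ∀ a : Fin m → L, (∀ i, aeval a (F i) = 0) → a = 0)
    {K : Type*} [Field K] {p : ℕ} [CharP K p] {a : Fin m → K} (ha0 : a ≠ 0)
    (ha : ∀ i, aeval a (F i) = 0) {D : ℕ} (hD : ∑ i, (d i - 1) < D) (hdD : ∀ i, d i ≤ D) :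
    p ≤ (Fintype.card (DegMonomial m D)).factorial *
      ∏ i, B i ^ Fintype.card (DegMonomial m (D - d i)) := by
  classical
  set f : Fin m → MvPolynomial (Fin m) L := fun i => map (Int.castRingHom L) (F i) with hfdef
  have hf : ∀ i, (f i).IsHomogeneous (d i) := fun i => (hF i).map _
  have hX : ∀ i, X i ∈ (Ideal.span (Set.range f)).radical := by
    refine X_mem_radical_of_forall_eq_zero fun a h => hL a fun i => ?_
    rw [← h i, hfdef, eval_map, aeval_def]
    rfl
  have hspan := span_range_degCoeff_macaulayRow hd hf hX hD hdD
  obtain ⟨κ, ρ, hρ, hsp, hli⟩ :=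
    exists_linearIndependent' L fun r => degCoeff L m D (macaulayRow f d D r)
  have b := Module.Basis.mk hli (by rw [hsp, hspan])
  set e : DegMonomial m D ≃ κ := (Pi.basisFun L (DegMonomial m D)).indexEquiv b
  set A : Matrix (DegMonomial m D) (DegMonomial m D) ℤ :=
    Matrix.of fun s s' => coeff s'.1 (macaulayRow F d D (ρ (e s))) with hA
  have hdet : A.det ≠ 0 := by
    -- over `L`, the rows of `A` are the basis chosen among the rows of the Macaulay matrix
    have h1 : LinearIndependent L (A.map (Int.castRingHom L)).row := by
      have h2 : (A.map (Int.castRingHom L)).row =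
          fun s => degCoeff L m D (macaulayRow f d D (ρ (e s))) := by
        funext s s'
        simp [hA, Matrix.row, degCoeff_apply, hfdef, ← map_macaulayRow, coeff_map]
      rw [h2]
      exact hli.comp e e.injective
    have h2 := (Matrix.isUnit_iff_isUnit_det _).mp (Matrix.linearIndependent_rows_iff_isUnit.mp h1)
    intro h0
    have h3 := RingHom.map_det (Int.castRingHom L) A
    rw [h0, map_zero] at h3
    exact h2.ne_zero h3.symm
  have hdvd : (p : ℤ) ∣ A.det := by
    rw [← CharP.intCast_eq_zero_iff K p]
    have h3 := RingHom.map_det (Int.castRingHom K) A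
    change ((A.det : ℤ) : K) = _ at h3
    rw [h3]
    -- the values of the monomials at the common zero are a kernel vector
    refine Matrix.exists_mulVec_eq_zero_iff.mp
      ⟨fun s => aeval a (monomial s.1 (1 : ℤ)), ?_, ?_⟩
    · obtain ⟨j, hj⟩ := Function.ne_iff.mp ha0
      have hjD : Finsupp.single j D ∈ Finset.univ.finsuppAntidiag D := by
        rw [mem_finsuppAntidiag_univ_iff]
        simp
      intro h0
      have := congrFun h0 ⟨_, hjD⟩
      simp only [aeval_monomial, map_one, one_mul, Pi.zero_apply] at this
      rw [Finsupp.prod_single_index (by simp)] at this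
      exact hj (eq_zero_of_pow_eq_zero this)
    · funext s
      have hrow := isHomogeneous_macaulayRow hF hdD (ρ (e s))
      have h4 : aeval a (macaulayRow F d D (ρ (e s))) = 0 := by
        rw [macaulayRow, map_mul, ha, mul_zero]
      rw [hrow.eq_sum_degMonomial, map_sum] at h4
      rw [Pi.zero_apply, ← h4]
      refine Finset.sum_congr rfl fun s' _ => ?_
      simp [hA, aeval_monomial]
  have hbound : |A.det| ≤ (Fintype.card (DegMonomial m D)).factorial *
      ∏ s, (B (ρ (e s)).1 : ℤ) := by
    refine Matrix.abs_det_le_factorial_mul_prod fun s s' => ?_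
    rw [hA, Matrix.of_apply, macaulayRow, coeff_monomial_mul']
    split_ifs
    · rw [one_mul]
      exact hFB _ _
    · simp
  have hprod : ∏ s, B (ρ (e s)).1 ≤ ∏ i, B i ^ Fintype.card (DegMonomial m (D - d i)) := by
    calc ∏ s, B (ρ (e s)).1
        = ∏ r ∈ Finset.univ.image fun s => ρ (e s), B r.1 := by
          rw [Finset.prod_image fun x _ y _ h => e.injective (hρ h)]
      _ ≤ ∏ r : MacaulayRow d D, B r.1 :=
          Finset.prod_le_prod_of_subset_of_one_le' (Finset.subset_univ _) fun r _ _ => hB r.1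
      _ = _ := by
          rw [← Finset.univ_sigma_univ, Finset.prod_sigma]
          simp
  have h5 : (p : ℤ) ≤ |A.det| := Int.le_of_dvd (abs_pos.mpr hdet) ((dvd_abs _ _).mpr hdvd)
  have h6 : (p : ℤ) ≤ ((Fintype.card (DegMonomial m D)).factorial * ∏ s, B (ρ (e s)).1 : ℕ) := by
    push_cast
    exact h5.trans hbound
  exact (Nat.cast_le.mp h6).trans (Nat.mul_le_mul_left _ hprod)

end MvPolynomial

/-! ### Hasse derivatives at the roots as forms in the differences of the roots -/

open Polynomial in
theorem exists_eq_prod_X_sub_C {K : Type*} [Field K] [IsAlgClosed K] {m : ℕ} {f : K[X]}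
    (hf : f.Monic) (hm : f.natDegree = m + 1) :
    ∃ ρ : Option (Fin m) → K, f = ∏ l, (X - C (ρ l)) := by
  have hs := IsAlgClosed.splits f
  have hlen : f.roots.toList.length = m + 1 := by
    rw [Multiset.length_toList, ← hs.natDegree_eq_card_roots, hm]
  let e : Option (Fin m) ≃ Fin f.roots.toList.length :=
    (finSuccEquiv m).symm.trans (finCongr hlen.symm)
  refine ⟨fun l => f.roots.toList[e l], ?_⟩
  have h := Fin.prod_univ_fun_getElem f.roots.toList fun z => X - C z
  rw [← Multiset.prod_coe, ← Multiset.map_coe, Multiset.coe_toList,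
    ← hs.eq_prod_roots_of_monic hf] at h
  exact h.symm.trans (e.prod_comp fun i => X - C f.roots.toList[i]).symm

open Polynomial in
/-- The Hasse derivative of a product of linear factors at one of the roots, as an elementary
symmetric function of the differences of the roots. -/
theorem eval_hasseDeriv_prod_X_sub_C {K : Type*} [CommRing K] {m i : ℕ}
    (ρ : Option (Fin m) → K) (j : Option (Fin m)) (hi : i ≤ m) :
    (hasseDeriv (m + 1 - i) (∏ l, (X - C (ρ l)))).eval (ρ j) =
      ∑ T ∈ (Finset.univ.erase j).powersetCard i, ∏ l ∈ T, (ρ j - ρ l) := by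
  have hcard : (Finset.univ.erase j).card = m := by
    rw [Finset.card_erase_of_mem (Finset.mem_univ j)]
    simp
  have htaylor : taylor (ρ j) (∏ l, (X - C (ρ l))) =
      X * ∏ l ∈ Finset.univ.erase j, (X + C (ρ j - ρ l)) := by
    have h1 : ∀ l, taylor (ρ j) (X - C (ρ l)) = X + C (ρ j - ρ l) := by
      intro l
      simp [add_sub_assoc]
    rw [← taylorAlgHom_apply, map_prod]
    simp only [taylorAlgHom_apply, h1]
    rw [← Finset.mul_prod_erase _ _ (Finset.mem_univ j)]
    simp
  rw [← taylor_coeff, htaylor, show m + 1 - i = (m - i) + 1 by omega, coeff_X_mul,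
    Finset.prod_X_add_C_coeff _ _ (by omega), hcard, Nat.sub_sub_self hi]

namespace MvPolynomial

/-- The roots `0, X 0, …, X (m - 1)` of the generic monic polynomial of degree `m + 1` that
vanishes at the origin; the root `0` has the index `none`. -/
noncomputable def genericRoot (m : ℕ) (l : Option (Fin m)) : MvPolynomial (Fin m) ℤ :=
  l.elim 0 X

/-- The value at its root with index `j` of the Hasse derivative of order `m + 1 - i` of the
polynomial with the roots `genericRoot m`. It is a form of degree `i`. -/
noncomputable def hasseForm (m i : ℕ) (j : Option (Fin m)) : MvPolynomial (Fin m) ℤ :=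
  ∑ T ∈ (Finset.univ.erase j).powersetCard i, ∏ l ∈ T, (genericRoot m j - genericRoot m l)

theorem isHomogeneous_genericRoot (m : ℕ) (l : Option (Fin m)) :
    (genericRoot m l).IsHomogeneous 1 := by
  cases l with
  | none => exact isHomogeneous_zero _ _ _
  | some l => exact isHomogeneous_X _ _

theorem isHomogeneous_hasseForm (m i : ℕ) (j : Option (Fin m)) :
    (hasseForm m i j).IsHomogeneous i := by
  refine IsHomogeneous.sum _ _ _ fun T hT => ?_
  have h := IsHomogeneous.prod T (fun l => genericRoot m j - genericRoot m l) (fun _ => 1)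
    fun l _ => (isHomogeneous_genericRoot m j).sub (isHomogeneous_genericRoot m l)
  simpa [(Finset.mem_powersetCard.mp hT).2] using h

/-- Every variable other than that of the root `j` occurs in at most one factor of the product, so
no two terms of its expansion belong to the same monomial. -/
theorem abs_coeff_prod_genericRoot_sub_le {m : ℕ} (j : Option (Fin m)) (T : Finset (Option (Fin m)))
    (hT : j ∉ T) :
    (∀ s, |coeff s (∏ l ∈ T, (genericRoot m j - genericRoot m l))| ≤ 1) ∧
      ∀ (l : Fin m) (s : Fin m →₀ ℕ), some l ∉ T → some l ≠ j → s l ≠ 0 →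
        coeff s (∏ l ∈ T, (genericRoot m j - genericRoot m l)) = 0 := by
  classical
  induction T using Finset.induction_on with
  | empty =>
    refine ⟨fun s => ?_, fun l s _ _ hs => ?_⟩
    · rw [Finset.prod_empty, coeff_one]
      split_ifs <;> simp
    · rw [Finset.prod_empty, coeff_one, if_neg]
      rintro rfl
      exact hs rfl
  | insert a T ha ih =>
    rw [Finset.mem_insert, not_or] at hT
    obtain ⟨ih1, ih2⟩ := ih hT.2
    rw [Finset.prod_insert ha]
    set P := ∏ l ∈ T, (genericRoot m j - genericRoot m l)
    have hXb : ∀ (v : Fin m) s, |coeff s (X v * P)| ≤ 1 := by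
      intro v s
      rw [coeff_X_mul']
      split_ifs
      · exact ih1 _
      · simp
    have hX0 : ∀ (v l : Fin m) (s : Fin m →₀ ℕ), v ≠ l → some l ∉ T → some l ≠ j → s l ≠ 0 →
        coeff s (X v * P) = 0 := by
      intro v l s hvl h1 h2 hs
      rw [coeff_X_mul']
      split_ifs
      · exact ih2 l _ h1 h2 (by simpa [Finsupp.single_apply, hvl] using hs)
      · rfl
    obtain _ | a := a
    · obtain _ | j := j
      · simp at hT
      simp only [genericRoot, Option.elim, sub_zero]
      refine ⟨hXb j, fun l s h1 h2 hs => hX0 j l s ?_ ?_ h2 hs⟩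
      · rintro rfl
        exact h2 rfl
      · exact fun h => h1 (Finset.mem_insert_of_mem h)
    · obtain _ | j := j
      · simp only [genericRoot, Option.elim, zero_sub, neg_mul, coeff_neg, abs_neg, neg_eq_zero]
        refine ⟨hXb a, fun l s h1 h2 hs => hX0 a l s ?_ ?_ h2 hs⟩
        · rintro rfl
          exact h1 (Finset.mem_insert_self _ _)
        · exact fun h => h1 (Finset.mem_insert_of_mem h)
      · have hja : j ≠ a := fun h => hT.1 (by rw [h])
        simp only [genericRoot, Option.elim, sub_mul, coeff_sub]
        refine ⟨fun s => ?_, fun l s h1 h2 hs => ?_⟩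
        · -- the factor adds the variable `a`, which distinguishes its two terms
          by_cases hs : s a = 0
          · have : coeff s (X a * P) = 0 := by
              rw [coeff_X_mul', if_neg (by simpa using hs)]
            rw [this, sub_zero]
            exact hXb j s
          · rw [hX0 j a s hja ha (fun h => hT.1 h.symm) hs, zero_sub, abs_neg]
            exact hXb a s
        · have h3 : some l ∉ T := fun h => h1 (Finset.mem_insert_of_mem h)
          rw [hX0 j l s (by rintro rfl; exact h2 rfl) h3 h2 hs,
            hX0 a l s (by rintro rfl; exact h1 (Finset.mem_insert_self _ _)) h3 h2 hs, sub_zero]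

theorem abs_coeff_hasseForm_le (m i : ℕ) (j : Option (Fin m)) (s : Fin m →₀ ℕ) :
    |coeff s (hasseForm m i j)| ≤ m.choose i := by
  rw [hasseForm, coeff_sum]
  refine (Finset.abs_sum_le_sum_abs _ _).trans ?_
  refine (Finset.sum_le_sum fun T hT => (abs_coeff_prod_genericRoot_sub_le j T ?_).1 s).trans ?_
  · exact fun h => Finset.notMem_erase j _ ((Finset.mem_powersetCard.mp hT).1 h)
  · simp [Finset.card_erase_of_mem]

/-- The forms `hasseForm` evaluate to the Hasse derivatives of a product of linear factors at its
roots. As only differences of roots occur, the roots need to be known up to translation only. -/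
theorem aeval_hasseForm {K : Type*} [CommRing K] {m i : ℕ} (ρ : Option (Fin m) → K)
    (j : Option (Fin m)) (hi : i ≤ m) :
    aeval (fun l => ρ (some l) - ρ none) (hasseForm m i j) =
      (Polynomial.hasseDeriv (m + 1 - i) (∏ l, (Polynomial.X - Polynomial.C (ρ l)))).eval
        (ρ j) := by
  have h : ∀ l, aeval (fun l => ρ (some l) - ρ none) (genericRoot m l) = ρ l - ρ none := by
    rintro (_ | l) <;> simp [genericRoot]
  rw [eval_hasseDeriv_prod_X_sub_C ρ j hi, hasseForm, map_sum]
  refine Finset.sum_congr rfl fun T _ => ?_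
  rw [map_prod]
  refine Finset.prod_congr rfl fun l _ => ?_
  rw [map_sub, h, h, sub_sub_sub_cancel_right]

end MvPolynomial

/-! ### Casas-Alvero polynomials and common zeros -/

open Polynomial in
/-- In characteristic zero, `CA` says that the forms belonging to any choice of common roots of
the polynomial and its Hasse derivatives vanish simultaneously at the origin only. -/
theorem eq_zero_of_aeval_hasseForm_eq_zero {m : ℕ} (hCA : CA.{u} (m + 1) 0) {L : Type u} [Field L]
    [IsAlgClosed L] [CharZero L] (σ : Fin m → Option (Fin m)) (a : Fin m → L)
    (ha : ∀ i : Fin m, MvPolynomial.aeval a (MvPolynomial.hasseForm m (i + 1) (σ i)) = 0) :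
    a = 0 := by
  set ρ : Option (Fin m) → L := fun l => l.elim 0 a with hρ
  have haρ : a = fun l => ρ (some l) - ρ none := by
    funext l
    simp [hρ]
  set f : L[X] := ∏ l, (X - C (ρ l)) with hf
  have hmonic : f.Monic := monic_prod_X_sub_C _ _
  have hdeg : f.natDegree = m + 1 := by
    rw [hf, natDegree_finsetProd_X_sub_C_eq_card]
    simp
  have hroot : ∀ l, f.eval (ρ l) = 0 := by
    intro l
    rw [hf, eval_prod]
    exact Finset.prod_eq_zero (Finset.mem_univ l) (by simp)
  have hCAf : IsCasasAlvero f := by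
    refine ⟨hmonic, by omega, fun k hk1 hk2 => ?_⟩
    have hkm : m - k < m := by omega
    refine ⟨X - C (ρ (σ ⟨m - k, hkm⟩)), by simp, dvd_iff_isRoot.mpr (hroot _),
      dvd_iff_isRoot.mpr ?_⟩
    have h := ha ⟨m - k, hkm⟩
    rw [haρ, MvPolynomial.aeval_hasseForm ρ _ (by simp; omega)] at h
    rwa [show m + 1 - (m - k + 1) = k by omega] at h
  obtain ⟨b, hb⟩ := hCA L f hCAf hdeg
  have hρb : ∀ l, ρ l = b := by
    intro l
    have h := hroot l
    rw [hb, eval_pow] at h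
    have := eq_zero_of_pow_eq_zero h
    simpa [sub_eq_zero] using this
  rw [haρ]
  funext l
  simp [hρb]

open Polynomial in
/-- A Casas-Alvero polynomial that is not a power of a linear factor yields a nontrivial common
zero of the forms belonging to some choice of common roots. -/
theorem exists_aeval_hasseForm_eq_zero {m : ℕ} {K : Type*} [Field K] [IsAlgClosed K] {f : K[X]}
    (hf : IsCasasAlvero f) (hdeg : f.natDegree = m + 1)
    (hne : ∀ b : K, f ≠ (X - C b) ^ (m + 1)) :
    ∃ (σ : Fin m → Option (Fin m)) (a : Fin m → K), a ≠ 0 ∧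
      ∀ i : Fin m, MvPolynomial.aeval a (MvPolynomial.hasseForm m (i + 1) (σ i)) = 0 := by
  obtain ⟨ρ, hρ⟩ := exists_eq_prod_X_sub_C hf.monic hdeg
  have key : ∀ i : Fin m, ∃ j, MvPolynomial.aeval (fun l => ρ (some l) - ρ none)
      (MvPolynomial.hasseForm m (i + 1) j) = 0 := by
    intro i
    obtain ⟨h, hpos, hhf, hhd⟩ := hf.commonFactor (m - i) (by omega) (by omega)
    obtain ⟨z, hz⟩ := IsAlgClosed.exists_root h (natDegree_pos_iff_degree_pos.mp hpos).ne'
    have hfz : f.eval z = 0 := hz.dvd hhf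
    rw [hρ, eval_prod, Finset.prod_eq_zero_iff] at hfz
    obtain ⟨j, _, hj⟩ := hfz
    have hzj : z = ρ j := by simpa [sub_eq_zero] using hj
    refine ⟨j, ?_⟩
    rw [MvPolynomial.aeval_hasseForm ρ j (by omega), ← hρ, ← hzj,
      show m + 1 - (i + 1) = m - i by omega]
    exact hz.dvd hhd
  choose σ hσ using key
  refine ⟨σ, _, fun h0 => hne (ρ none) ?_, hσ⟩
  have hconst : ∀ l, ρ l = ρ none := by
    rintro (_ | l)
    · rfl
    · exact sub_eq_zero.mp (congrFun h0 l)
  rw [hρ]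
  simp [hconst]

/-! ### The numbers in the bound -/

theorem critDegree_add_two (t : ℕ) : critDegree (t + 2) = ∑ i ∈ Finset.range (t + 1), i + 1 := by
  rw [Finset.sum_range_id, critDegree]
  have h : (t + 2) ^ 2 + 4 - 3 * (t + 2) = (t + 1) * (t + 1 - 1) + 2 := by
    rw [Nat.add_sub_cancel]
    have : (t + 2) ^ 2 + 4 = (t + 1) * t + 2 + 3 * (t + 2) := by ring
    omega
  rw [h, Nat.add_div_right _ (by norm_num)]

theorem card_degMonomial_add_one (t D : ℕ) :
    Fintype.card (MvPolynomial.DegMonomial (t + 1) D) = (D + t).choose t := by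
  rw [MvPolynomial.card_degMonomial, show t + 1 + D - 1 = D + t by omega, Nat.choose_symm_add]

theorem card_degMonomial_critDegree (t : ℕ) :
    Fintype.card (MvPolynomial.DegMonomial (t + 1) (critDegree (t + 2))) =
      numMonomials (t + 2) := by
  rw [card_degMonomial_add_one, numMonomials, critDegree_add_two, Nat.add_sub_cancel]
  congr 1
  have h1 := Finset.sum_range_succ (fun i => i) (t + 1)
  rw [show t + 1 + 1 = t + 2 from rfl] at h1
  have h2 : ∑ i ∈ Finset.range (t + 2), i = ((t + 2) ^ 2 - (t + 2)) / 2 := by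
    rw [Finset.sum_range_id, Nat.mul_sub_one, sq]
  omega

theorem three_le_numMonomials {t : ℕ} (ht : 1 ≤ t) : 3 ≤ numMonomials (t + 2) := by
  rw [← card_degMonomial_critDegree, card_degMonomial_add_one, critDegree_add_two]
  have h1 : t ≤ ∑ i ∈ Finset.range (t + 1), i :=
    Finset.single_le_sum (f := fun i : ℕ => i) (fun _ _ => Nat.zero_le _) (by simp)
  calc 3 = Nat.choose 3 2 := rfl
    _ ≤ (2 + t).choose 2 := Nat.choose_le_choose 2 (by omega)
    _ = (2 + t).choose t := Nat.choose_symm_add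
    _ ≤ _ := Nat.choose_le_choose t (by omega)

/-! ### The bound for bad primes -/

theorem mainTheorem2 (n : ℕ) (hn : 1 ≤ n) (hCA : CA.{u} n 0)
    (p : ℕ) (hp : IsBadPrime.{v} n p) :
    p < (numMonomials n).factorial *
      ∏ i ∈ Finset.Icc 1 (n - 1),
        (i + n - 2).choose (n - 2) ^ (critDegree n - i + n - 2).choose (n - 2) := by
  obtain ⟨hprime, hbad⟩ := hp
  obtain ⟨m, rfl⟩ := Nat.exists_eq_add_of_le' hn
  simp only [CA, not_forall] at hbad
  obtain ⟨K, _, _, _, f, hf, hdeg, hne⟩ := hbad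
  obtain ⟨σ, a, ha0, ha⟩ := exists_aeval_hasseForm_eq_zero hf hdeg fun b hb => hne ⟨b, hb⟩
  obtain ⟨t, rfl⟩ : ∃ t, m = t + 1 := by
    obtain ⟨l, -⟩ := Function.ne_iff.mp ha0
    exact ⟨m - 1, by have := l.pos; omega⟩
  have hD : ∑ i : Fin (t + 1), ((i : ℕ) + 1 - 1) < critDegree (t + 2) := by
    simp only [Nat.add_sub_cancel]
    rw [critDegree_add_two, Fin.sum_univ_eq_sum_range (fun i => i)]
    exact Nat.lt_succ_self _
  have hdD : ∀ i : Fin (t + 1), (i : ℕ) + 1 ≤ critDegree (t + 2) := by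
    intro i
    refine le_trans ?_ (Nat.succ_le_of_lt hD)
    exact Nat.succ_le_succ (Finset.single_le_sum (f := fun i : Fin (t + 1) => (i : ℕ) + 1 - 1)
      (fun _ _ => Nat.zero_le _) (Finset.mem_univ i))
  have : CharZero (ULift.{u} ℚ) :=
    charZero_of_injective_ringHom (f := (ULift.ringEquiv.symm : ℚ ≃+* ULift.{u} ℚ).toRingHom)
      ULift.ringEquiv.symm.injective
  -- the coefficients are at most `(t + 1).choose (i + 1)`; the larger `B i` is the number of
  -- monomials of degree `i + 1`
  have hle := MvPolynomial.prime_le_of_forall_eq_zero_of_exists_ne_zero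
    (F := fun i : Fin (t + 1) => MvPolynomial.hasseForm (t + 1) (i + 1) (σ i))
    (d := fun i => (i : ℕ) + 1) (B := fun i => ((i : ℕ) + 1 + t).choose t)
    (fun i => Nat.succ_pos _) (fun i => MvPolynomial.isHomogeneous_hasseForm _ _ _)
    (fun i => Nat.choose_pos (by omega))
    (fun i s => (MvPolynomial.abs_coeff_hasseForm_le _ _ _ s).trans ?_)
    (L := AlgebraicClosure (ULift.{u} ℚ))
    (eq_zero_of_aeval_hasseForm_eq_zero hCA σ) (p := p) ha0 ha hD hdD
  swap
  · rw [← Nat.choose_symm_add]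
    exact_mod_cast Nat.choose_le_choose _ (by omega)
  rw [card_degMonomial_critDegree] at hle
  simp only [card_degMonomial_add_one] at hle
  have hprod : ∏ i : Fin (t + 1), ((i : ℕ) + 1 + t).choose t ^
        (critDegree (t + 2) - ((i : ℕ) + 1) + t).choose t =
      ∏ i ∈ Finset.Icc 1 (t + 1 + 1 - 1), (i + (t + 1 + 1) - 2).choose (t + 1 + 1 - 2) ^
        (critDegree (t + 1 + 1) - i + (t + 1 + 1) - 2).choose (t + 1 + 1 - 2) := by
    rw [Fin.prod_univ_eq_prod_range (fun i => (i + 1 + t).choose t ^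
      (critDegree (t + 2) - (i + 1) + t).choose t), Finset.range_eq_Ico,
      Finset.prod_Ico_add' (fun i => (i + t).choose t ^
      (critDegree (t + 2) - i + t).choose t) 0 (t + 1) 1]
    rfl
  rw [hprod] at hle
  refine lt_of_le_of_ne hle fun heq => ?_
  obtain rfl | ht := Nat.eq_zero_or_pos t
  · -- for quadratic polynomials the bound is `1`
    simp [numMonomials] at heq
    exact hprime.one_lt.ne' heq
  · -- otherwise the bound is divisible by `3!`, so it is not prime
    have h6 : 6 ∣ p := by
      rw [heq]
      exact (Nat.factorial_dvd_factorial (three_le_numMonomials ht)).mul_right _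
    have h2 := (Nat.prime_dvd_prime_iff_eq Nat.prime_two hprime).mp (dvd_trans (by norm_num) h6)
    have h3 := (Nat.prime_dvd_prime_iff_eq Nat.prime_three hprime).mp (dvd_trans (by norm_num) h6)
    omega
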